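/- Let $B=\{b_1,\dots,b_n\}\subseteq\mathbb{Z}^m$ be a finite configuration of lattice vectors (repetitions and the zero vector are allowed), and for $B'\subseteq B$ let $\mathrm{cone}(B')\subseteq\mathbb{R}^m$ be the set of all non-negative real combinations of $B'$, so that $\mathrm{cone}(\emptyset)=\{0\}$. Call $B$ *supernormal* if, for every subset $B'\subseteq B$, every lattice point in $\mathrm{cone}(B')$ is a non-negative integer combination of the vectors in $B\cap\mathrm{cone}(B')$. Let $k$ be a field. For $u\in\mathbb{Z}^m$ put $$f_u=\prod_{i:\,u\cdot b_i>0}x_i^{u\cdot b_i}-\prod_{j:\,u\cdot b_j<0}x_j^{-u\cdot b_j}\in k[x_1,\dots,x_n],$$ and let $J_B=\langle f_u : u\in\mathbb{Z}^m\rangle$ be the lattice ideal of $B$. For $w\in\mathrm{cone}(B)$, the initial ideal $\mathrm{in}_w(J_B)$ is the ideal generated by the monomials $\prod_{i:\,u\cdot b_i>0}x_i^{u\cdot b_i}$ for $u\in\mathbb{Z}^m$ with $u\cdot w>0$, together with the binomials $f_u$ for $u\in\mathbb{Z}^m$ with $u\cdot w=0$. Two vectors $w,w'\in\mathrm{cone}(B)$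 lie in the same cell of the *Gröbner fan* of $J_B$ if $\mathrm{in}_w(J_B)=\mathrm{in}_{w'}(J_B)$; they lie in the same cell of the *chamber complex* of $B$ if, for every subset $B'\subseteq B$, $w\in\mathrm{cone}(B')$ if and only if $w'\in\mathrm{cone}(B')$. **Theorem.** If $B$ is supernormal, then the chamber complex of $B$ coincides with the Gröbner fan of $J_B$; that is, the two partitions of $\mathrm{cone}(B)$ into cells are equal. -/

import Mathlib

open scoped Matrix

namespace VectorConfig

noncomputable section

/-- The inclusion of the lattice `ℤ^m` into `ℝ^m`. -/
def toReal {m : ℕ} (z : Fin m → ℤ) : Fin m → ℝ := fun j => (z j : ℝ)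

/-- For a configuration `b_1, …, b_n` in `ℤ^m` and a set `S` of indices, the polyhedral cone in
`ℝ^m` of all non-negative real combinations of the `b_i` with `i ∈ S`
(the cone over the empty set is `{0}`). -/
def cone {m n : ℕ} (b : Fin n → Fin m → ℤ) (S : Set (Fin n)) : PointedCone ℝ (Fin m → ℝ) :=
  PointedCone.hull ℝ ((fun i => toReal (b i)) '' S)

/-- A configuration `B` is supernormal if, for every subset `B'` of `B`, every lattice point in
`cone(B')` is a non-negative integer combination of `B ∩ cone(B')`. -/
def Supernormal {m n : ℕ} (b : Fin n → Fin m → ℤ) : Prop :=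
  ∀ S : Set (Fin n), ∀ z : Fin m → ℤ, toReal z ∈ cone b S →
    z ∈ AddSubmonoid.closure (b '' {i | toReal (b i) ∈ cone b S})

/-- The monomial `∏_{i : u · b_i > 0} x_i ^ (u · b_i)`;
the factors with `u · b_i ≤ 0` have exponent `0`. -/
def posMonomial (k : Type*) [Field k] {m n : ℕ} (b : Fin n → Fin m → ℤ) (u : Fin m → ℤ) :
    MvPolynomial (Fin n) k :=
  ∏ i, MvPolynomial.X i ^ (u ⬝ᵥ b i).toNat

/-- The binomial
`∏_{i : u · b_i > 0} x_i ^ (u · b_i) - ∏_{j : u · b_j < 0} x_j ^ (-(u · b_j))`. -/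
def binomial (k : Type*) [Field k] {m n : ℕ} (b : Fin n → Fin m → ℤ) (u : Fin m → ℤ) :
    MvPolynomial (Fin n) k :=
  posMonomial k b u - posMonomial k b (-u)

/-- The lattice ideal `J_B`, generated by the binomials of all `u ∈ ℤ^m`. -/
def latticeIdeal (k : Type*) [Field k] {m n : ℕ} (b : Fin n → Fin m → ℤ) :
    Ideal (MvPolynomial (Fin n) k) :=
  Ideal.span {p | ∃ u : Fin m → ℤ, p = binomial k b u}

/-- The initial ideal `in_w(J_B)` of the lattice ideal: it is generated by the monomials
`∏_{i : u · b_i > 0} x_i ^ (u · b_i)` with `u · w > 0` (the leading terms of the binomials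
that are not `w`-homogeneous) and the binomials with `u · w = 0`. -/
def initialIdeal (k : Type*) [Field k] {m n : ℕ} (b : Fin n → Fin m → ℤ) (w : Fin m → ℝ) :
    Ideal (MvPolynomial (Fin n) k) :=
  Ideal.span ({p | ∃ u : Fin m → ℤ, 0 < toReal u ⬝ᵥ w ∧ p = posMonomial k b u} ∪
    {p | ∃ u : Fin m → ℤ, toReal u ⬝ᵥ w = 0 ∧ p = binomial k b u})

/-- For the weight `w = 0` nothing is lost: `in_0(J_B) = J_B`. -/
theorem initialIdeal_zero (k : Type*) [Field k] {m n : ℕ} (b : Fin n → Fin m → ℤ) :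
    initialIdeal k b 0 = latticeIdeal k b := by
  simp [initialIdeal, latticeIdeal]

/-- The cell of `w` in the Gröbner fan of `J_B`: all `w' ∈ cone(B)` with
`in_{w'}(J_B) = in_w(J_B)`. -/
def groebnerCell (k : Type*) [Field k] {m n : ℕ} (b : Fin n → Fin m → ℤ) (w : Fin m → ℝ) :
    Set (Fin m → ℝ) :=
  {w' | w' ∈ cone b Set.univ ∧ initialIdeal k b w' = initialIdeal k b w}

/-- The Gröbner fan of `J_B`, as the partition of `cone(B)` into its cells. -/
def groebnerFan (k : Type*) [Field k] {m n : ℕ} (b : Fin n → Fin m → ℤ) :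
    Set (Set (Fin m → ℝ)) :=
  {C | ∃ w ∈ cone b Set.univ, C = groebnerCell k b w}

/-- The cell of `w` in the chamber complex of `B`: all `w' ∈ cone(B)` that lie in exactly the
same cones `cone(B')`, `B' ⊆ B`, as `w`. -/
def chamberCell {m n : ℕ} (b : Fin n → Fin m → ℤ) (w : Fin m → ℝ) : Set (Fin m → ℝ) :=
  {w' | w' ∈ cone b Set.univ ∧ ∀ S : Set (Fin n), w' ∈ cone b S ↔ w ∈ cone b S}

/-- The chamber complex of `B`, as the partition of `cone(B)` into its cells. -/
def chamberComplex {m n : ℕ} (b : Fin n → Fin m → ℤ) : Set (Set (Fin m → ℝ)) :=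
  {C | ∃ w ∈ cone b Set.univ, C = chamberCell b w}

end

end VectorConfig

/-! Monomials of the initial ideals are governed by integer programs. For `u` let `P` be the
polyhedron `y · b_i ≤ max (u · b_i) 0`. If the positive monomial of `u` is not in `in_w`, then `0`
maximizes `w` over the lattice points of `P`; if that of `-u` is not, then `u` does.

Supernormality makes such a polyhedron integral once its bounds are tightened to values attained at
lattice points (`Supernormal.exists_lattice_point`). Integer optimality of `z` then has an LP
certificate: `w` lies in the cone of the `b_i` that `z` maximizes (`Supernormal.mem_cone_of_isMax`).
Points in one chamber share these certificates, hence the optima, hence the initial ideal.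

The converse needs no supernormality. If `w ∈ cone b S` but `w' ∉ cone b S`, an integral separating
functional gives a monomial of `in_{w'}`, while a 0/1 zero of `in_w` shows that this monomial is not
in `in_w`. -/

namespace VectorConfig

variable {m n : ℕ} {b : Fin n → Fin m → ℤ}

/-! ### Farkas' lemma -/

/-- **Farkas' lemma** for finitely many linear functionals, without any topology. -/
theorem exists_nonneg_combination {V ι : Type*} [AddCommGroup V] [Module ℝ V] (S : Finset ι) :
    ∀ (a : ι → Module.Dual ℝ V) (g : Module.Dual ℝ V),
      (∀ x, (∀ i ∈ S, a i x ≤ 0) → g x ≤ 0) →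
      ∃ c : ι → ℝ, (∀ i, 0 ≤ c i) ∧ g = ∑ i ∈ S, c i • a i := by
  classical
  induction S using Finset.induction_on with
  | empty =>
    intro a g h
    refine ⟨0, fun _ => le_rfl, ?_⟩
    ext x
    have h1 := h x (by simp)
    have h2 := h (-x) (by simp)
    simp only [map_neg] at h2
    simp only [Finset.sum_empty, LinearMap.zero_apply]
    linarith
  | insert j S hj ih =>
    intro a g h
    by_cases hS : ∀ x, (∀ i ∈ S, a i x ≤ 0) → g x ≤ 0
    · obtain ⟨c, hc, hg⟩ := ih a g hS
      refine ⟨fun i => if i = j then 0 else c i, fun i => ?_, ?_⟩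
      · dsimp only
        split_ifs
        exacts [le_rfl, hc i]
      · rw [Finset.sum_insert hj, hg]
        simp only [if_true, zero_smul, zero_add]
        refine Finset.sum_congr rfl fun i hi => ?_
        rw [if_neg (by rintro rfl; exact hj hi)]
    · push Not at hS
      obtain ⟨x, hx, hgx⟩ := hS
      have hjx : 0 < a j x := by
        by_contra hle
        refine absurd (h x fun i hi => ?_) (not_le.2 hgx)
        rcases Finset.mem_insert.1 hi with rfl | hi
        exacts [not_lt.1 hle, hx i hi]
      -- Precompose all functionals with the projection `y ↦ y - (a j y / a j x) • x` onto `ker (a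
      -- j)` along `x`; this eliminates `a j`.
      obtain ⟨c, hc, hg⟩ := ih (fun i => a i - (a i x / a j x) • a j)
        (g - (g x / a j x) • a j) (by
          intro y hy
          have := h (y - (a j y / a j x) • x) (by
            intro i hi
            rcases Finset.mem_insert.1 hi with rfl | hi
            · simp [hjx.ne']
            · have := hy i hi
              simp only [LinearMap.sub_apply, LinearMap.smul_apply, smul_eq_mul] at this
              simp only [map_sub, map_smul, smul_eq_mul]
              convert this using 1
              ring)
          simp only [map_sub, map_smul, smul_eq_mul] at this
          simp only [LinearMap.sub_apply, LinearMap.smul_apply, smul_eq_mul]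
          convert this using 1
          ring)
      -- The coefficient of `a j` collects the corrections; it is non-negative because `a i x ≤ 0`
      -- on `S` and `g x`, `a j x` are positive.
      refine ⟨fun i => if i = j then g x / a j x - ∑ i ∈ S, c i * (a i x / a j x) else c i,
        fun i => ?_, ?_⟩
      · dsimp only
        split_ifs
        · have h1 : ∑ i ∈ S, c i * (a i x / a j x) ≤ 0 :=
            Finset.sum_nonpos fun i hi => mul_nonpos_of_nonneg_of_nonpos (hc i)
              (div_nonpos_of_nonpos_of_nonneg (hx i hi) hjx.le)
          have h2 : 0 ≤ g x / a j x := by positivity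
          linarith
        · exact hc i
      · rw [Finset.sum_insert hj]
        simp only [if_true]
        have h1 : ∑ i ∈ S, (if i = j then g x / a j x - ∑ i ∈ S, c i * (a i x / a j x) else c i) • a i
            = ∑ i ∈ S, c i • a i :=
          Finset.sum_congr rfl fun i hi => by rw [if_neg (by rintro rfl; exact hj hi)]
        rw [h1]
        generalize g x / a j x = q at hg ⊢
        rw [sub_eq_iff_eq_add] at hg
        rw [hg]
        simp only [smul_sub, Finset.sum_sub_distrib, smul_smul, ← Finset.sum_smul]
        module

/-! ### Cones and separation -/

theorem toReal_add (x y : Fin m → ℤ) : toReal (x + y) = toReal x + toReal y := by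
  ext; simp [toReal]

theorem toReal_sub (x y : Fin m → ℤ) : toReal (x - y) = toReal x - toReal y := by
  ext; simp [toReal]

theorem toReal_neg (x : Fin m → ℤ) : toReal (-x) = -toReal x := by
  ext; simp [toReal]

theorem toReal_dotProduct_toReal (x y : Fin m → ℤ) :
    toReal x ⬝ᵥ toReal y = ((x ⬝ᵥ y : ℤ) : ℝ) := by
  simp [toReal, dotProduct]

theorem mem_cone_iff {S : Set (Fin n)} {x : Fin m → ℝ} :
    x ∈ cone b S ↔ ∃ c : Fin n → ℝ, (∀ i, 0 ≤ c i) ∧ (∀ i ∉ S, c i = 0) ∧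
      x = ∑ i, c i • toReal (b i) := by
  classical
  constructor
  · intro h
    induction h using Submodule.span_induction with
    | mem x hx =>
      obtain ⟨i, hi, rfl⟩ := hx
      refine ⟨Pi.single i 1, fun j => ?_, fun j hj => ?_, ?_⟩
      · by_cases h : j = i
        · subst h; simp
        · simp [h]
      · exact Pi.single_eq_of_ne (by rintro rfl; exact hj hi) _
      · simp [Pi.single_apply]
    | zero => exact ⟨0, by simp, by simp, by simp⟩
    | add x y _ _ hx hy =>
      obtain ⟨c, hc, hcS, rfl⟩ := hx
      obtain ⟨d, hd, hdS, rfl⟩ := hy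
      refine ⟨c + d, fun i => add_nonneg (hc i) (hd i), fun i hi => ?_, ?_⟩
      · simp [hcS i hi, hdS i hi]
      · simp [add_smul, Finset.sum_add_distrib]
    | smul r x _ hx =>
      obtain ⟨c, hc, hcS, rfl⟩ := hx
      refine ⟨fun i => r * c i, fun i => mul_nonneg r.2 (hc i), fun i hi => by simp [hcS i hi], ?_⟩
      rw [Finset.smul_sum]
      exact Finset.sum_congr rfl fun i _ => by rw [mul_smul]; rfl
  · rintro ⟨c, hc, hcS, rfl⟩
    refine Submodule.sum_mem _ fun i _ => ?_
    by_cases hi : i ∈ S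
    · exact PointedCone.smul_mem _ (hc i) (Submodule.subset_span ⟨i, hi, rfl⟩)
    · simp [hcS i hi]

theorem toReal_mem_cone {S : Set (Fin n)} {i : Fin n} (hi : i ∈ S) : toReal (b i) ∈ cone b S :=
  Submodule.subset_span ⟨i, hi, rfl⟩

theorem dotProduct_nonpos_of_mem_cone {S : Set (Fin n)} {x d : Fin m → ℝ} (hx : x ∈ cone b S)
    (hd : ∀ i ∈ S, d ⬝ᵥ toReal (b i) ≤ 0) : d ⬝ᵥ x ≤ 0 := by
  obtain ⟨c, hc, hcS, rfl⟩ := mem_cone_iff.1 hx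
  rw [dotProduct_sum]
  refine Finset.sum_nonpos fun i _ => ?_
  rw [dotProduct_smul, smul_eq_mul]
  by_cases hi : i ∈ S
  · exact mul_nonpos_of_nonneg_of_nonpos (hc i) (hd i hi)
  · simp [hcS i hi]

theorem dotProduct_eq_zero_of_mem_cone {S : Set (Fin n)} {x d : Fin m → ℝ} (hx : x ∈ cone b S)
    (hd : ∀ i ∈ S, d ⬝ᵥ toReal (b i) = 0) : d ⬝ᵥ x = 0 := by
  have h1 := dotProduct_nonpos_of_mem_cone hx fun i hi => (hd i hi).le
  have h2 := dotProduct_nonpos_of_mem_cone (d := -d) hx fun i hi => by simp [hd i hi]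
  rw [neg_dotProduct] at h2
  linarith

/-- A point outside `cone b S` is separated from it by a linear functional. -/
theorem exists_dotProduct_pos_of_notMem_cone {S : Set (Fin n)} {w : Fin m → ℝ}
    (hw : w ∉ cone b S) :
    ∃ d : Fin m → ℝ, (∀ i ∈ S, d ⬝ᵥ toReal (b i) ≤ 0) ∧ 0 < d ⬝ᵥ w := by
  classical
  by_contra! H
  obtain ⟨c, hc, h⟩ := exists_nonneg_combination S.toFinset
    (fun i => dotProductBilin ℝ ℝ (toReal (b i))) (dotProductBilin ℝ ℝ w) (by
      intro x hx
      have := H x fun i hi => by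
        have := hx i (Set.mem_toFinset.2 hi)
        simpa [dotProduct_comm] using this
      simpa [dotProduct_comm] using this)
  apply hw
  have : w = ∑ i ∈ S.toFinset, c i • toReal (b i) := by
    refine dotProduct_eq _ _ fun x => ?_
    have := LinearMap.congr_fun h x
    simpa [sum_dotProduct] using this
  rw [this]
  exact Submodule.sum_mem _ fun i hi =>
    PointedCone.smul_mem _ (hc i) (toReal_mem_cone (Set.mem_toFinset.1 hi))

/-! ### Vertices of polyhedra -/

/-- From a point of the polyhedron `{u | u · b_i ≤ a_i}` one can move along a direction with
non-negative objective until a further constraint becomes tight. -/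
theorem exists_more_active {a : Fin n → ℝ} {w u d : Fin m → ℝ}
    (hu : ∀ i, u ⬝ᵥ toReal (b i) ≤ a i) (hd : ∀ i, u ⬝ᵥ toReal (b i) = a i → d ⬝ᵥ toReal (b i) = 0)
    (hdw : 0 ≤ d ⬝ᵥ w) (hpos : ∃ j, 0 < d ⬝ᵥ toReal (b j)) :
    ∃ v : Fin m → ℝ, (∀ i, v ⬝ᵥ toReal (b i) ≤ a i) ∧ u ⬝ᵥ w ≤ v ⬝ᵥ w ∧
      (Finset.univ.filter fun i => v ⬝ᵥ toReal (b i) ≠ a i) ⊂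
        Finset.univ.filter fun i => u ⬝ᵥ toReal (b i) ≠ a i := by
  -- Ratio test: `j` is the first constraint hit when moving along `d`.
  obtain ⟨j, hj, hmin⟩ := Finset.exists_min_image
    (Finset.univ.filter fun i => 0 < d ⬝ᵥ toReal (b i))
    (fun i => (a i - u ⬝ᵥ toReal (b i)) / (d ⬝ᵥ toReal (b i)))
    (by obtain ⟨j, hj⟩ := hpos; exact ⟨j, by simpa using hj⟩)
  simp only [Finset.mem_filter, Finset.mem_univ, true_and] at hj hmin
  set t := (a j - u ⬝ᵥ toReal (b j)) / (d ⬝ᵥ toReal (b j)) with ht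
  have ht0 : 0 ≤ t := div_nonneg (sub_nonneg.2 (hu j)) hj.le
  refine ⟨u + t • d, fun i => ?_, ?_, ?_⟩
  · rw [add_dotProduct, smul_dotProduct, smul_eq_mul]
    rcases lt_or_ge 0 (d ⬝ᵥ toReal (b i)) with h | h
    · have := (le_div_iff₀ h).1 (hmin i h)
      linarith
    · have := mul_nonpos_of_nonneg_of_nonpos ht0 h
      linarith [hu i]
  · rw [add_dotProduct, smul_dotProduct, smul_eq_mul]
    have := mul_nonneg ht0 hdw
    linarith
  · rw [Finset.ssubset_iff_of_subset]
    · refine ⟨j, ?_, ?_⟩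
      · simp only [Finset.mem_filter, Finset.mem_univ, true_and]
        exact fun h => hj.ne' (hd j h)
      · simp only [Finset.mem_filter, Finset.mem_univ, true_and, not_not]
        rw [add_dotProduct, smul_dotProduct, smul_eq_mul, ht, div_mul_cancel₀ _ hj.ne']
        ring
    · intro i
      simp only [Finset.mem_filter, Finset.mem_univ, true_and]
      refine mt fun h => ?_
      rw [add_dotProduct, smul_dotProduct, hd i h, h]
      simp

/-- Each point of `{u | u · b_i ≤ a_i}` is dominated, with respect to an objective `w` in the cone
of the `b_i`, by a point at which the tight constraints determine all values `u · b_j`. -/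
theorem exists_vertex (a : Fin n → ℝ) {w : Fin m → ℝ} (hw : w ∈ cone b Set.univ) (u : Fin m → ℝ)
    (hu : ∀ i, u ⬝ᵥ toReal (b i) ≤ a i) :
    ∃ v : Fin m → ℝ, (∀ i, v ⬝ᵥ toReal (b i) ≤ a i) ∧ u ⬝ᵥ w ≤ v ⬝ᵥ w ∧
      ∀ d : Fin m → ℝ, (∀ i, v ⬝ᵥ toReal (b i) = a i → d ⬝ᵥ toReal (b i) = 0) →
        ∀ j, d ⬝ᵥ toReal (b j) = 0 := by
  induction hk : (Finset.univ.filter fun i => u ⬝ᵥ toReal (b i) ≠ a i)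
    using Finset.strongInduction generalizing u with
  | H s ih =>
    subst hk
    by_cases H : ∀ d : Fin m → ℝ, (∀ i, u ⬝ᵥ toReal (b i) = a i → d ⬝ᵥ toReal (b i) = 0) →
        ∀ j, d ⬝ᵥ toReal (b j) = 0
    · exact ⟨u, hu, le_rfl, H⟩
    · obtain ⟨e, he, hew, j, hej⟩ : ∃ d : Fin m → ℝ,
          (∀ i, u ⬝ᵥ toReal (b i) = a i → d ⬝ᵥ toReal (b i) = 0) ∧ 0 ≤ d ⬝ᵥ w ∧
          ∃ j, 0 < d ⬝ᵥ toReal (b j) := by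
        push Not at H
        obtain ⟨d, hd, j, hj⟩ := H
        obtain ⟨d, hd, hdw, j, hj⟩ : ∃ d : Fin m → ℝ,
            (∀ i, u ⬝ᵥ toReal (b i) = a i → d ⬝ᵥ toReal (b i) = 0) ∧ 0 ≤ d ⬝ᵥ w ∧
            ∃ j, d ⬝ᵥ toReal (b j) ≠ 0 := by
          rcases le_total 0 (d ⬝ᵥ w) with h | h
          · exact ⟨d, hd, h, j, hj⟩
          · exact ⟨-d, fun i hi => by simp [hd i hi], by simpa using h, j, by simpa using hj⟩
        -- If no `d · b_j` is positive, then `d · w ≤ 0` since `w` is in the cone, so `d · w = 0`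
        -- and `-d` serves.
        by_cases h : ∃ j, 0 < d ⬝ᵥ toReal (b j)
        · exact ⟨d, hd, hdw, h⟩
        · push Not at h
          have h0 := dotProduct_nonpos_of_mem_cone hw fun i _ => h i
          exact ⟨-d, fun i hi => by simp [hd i hi], by simpa using h0, j, by
            simpa using lt_of_le_of_ne (h j) hj⟩
      obtain ⟨v, hv, huv, hlt⟩ := exists_more_active hu he hew ⟨j, hej⟩
      obtain ⟨v', hv', hvv', hdet⟩ := ih _ hlt v hv rfl
      exact ⟨v', hv', huv.trans hvv', hdet⟩

/-! ### Integrality from supernormality -/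

/-- A linear form that is integral on a saturated sublattice agrees there with an integral form. -/
theorem exists_integral_form (M : Submodule ℤ (Fin m → ℤ))
    (hM : ∀ (k : ℤ) (z : Fin m → ℤ), k ≠ 0 → k • z ∈ M → z ∈ M) (u : Fin m → ℝ)
    (hu : ∀ z ∈ M, ∃ k : ℤ, u ⬝ᵥ toReal z = k) :
    ∃ v : Fin m → ℤ, ∀ z ∈ M, u ⬝ᵥ toReal z = ((v ⬝ᵥ z : ℤ) : ℝ) := by
  choose f hf using fun z : M => hu z z.2
  let F : M →+ ℤ := AddMonoidHom.mk' f fun x y => by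
    have := hf (x + y)
    rw [Submodule.coe_add, toReal_add, dotProduct_add, hf, hf] at this
    exact_mod_cast this.symm
  -- Saturation makes the quotient torsion-free, hence projective; so `M` is a direct summand, and a
  -- form on `M` extends along the projection `π`.
  have : Module.IsTorsionFree ℤ ((Fin m → ℤ) ⧸ M) := by
    refine Module.IsTorsionFree.of_smul_eq_zero fun k x hx => ?_
    obtain ⟨z, rfl⟩ := M.mkQ_surjective x
    by_cases hk : k = 0
    · exact Or.inl hk
    · right
      rw [← map_smul, Submodule.mkQ_apply, Submodule.Quotient.mk_eq_zero] at hx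
      rw [Submodule.mkQ_apply, Submodule.Quotient.mk_eq_zero]
      exact hM k z hk hx
  obtain ⟨s, hs⟩ := Module.projective_lifting_property M.mkQ LinearMap.id M.mkQ_surjective
  have hπ : ∀ x, (LinearMap.id - s ∘ₗ M.mkQ : (Fin m → ℤ) →ₗ[ℤ] _) x ∈ M := fun x => by
    rw [← Submodule.Quotient.mk_eq_zero, ← Submodule.mkQ_apply]
    have := LinearMap.congr_fun hs (M.mkQ x)
    simp only [LinearMap.comp_apply, LinearMap.id_apply] at this
    simp only [LinearMap.sub_apply, LinearMap.id_apply, LinearMap.comp_apply, map_sub, this,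
      sub_self]
  let π := LinearMap.codRestrict M _ hπ
  let G : (Fin m → ℤ) →ₗ[ℤ] ℤ := F.toIntLinearMap ∘ₗ π
  refine ⟨fun i => G (Pi.single i 1), fun z hz => ?_⟩
  have hG : G z = f ⟨z, hz⟩ := by
    have : π z = ⟨z, hz⟩ := by
      ext1
      have : M.mkQ z = 0 := by simpa using hz
      simp [π, LinearMap.codRestrict_apply, -Submodule.mkQ_apply, this]
    simp only [G, LinearMap.comp_apply, this]
    rfl
  rw [hf ⟨z, hz⟩, ← hG]
  congr 1
  rw [LinearMap.pi_apply_eq_sum_univ G z]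
  refine Finset.sum_congr rfl fun i _ => ?_
  rw [smul_eq_mul, mul_comm]
  congr 2
  ext j
  simp [Pi.single_apply, eq_comm]

theorem toReal_zsmul (k : ℤ) (x : Fin m → ℤ) : toReal (k • x) = (k : ℝ) • toReal x := by
  ext; simp [toReal]

theorem toReal_sum {ι : Type*} (s : Finset ι) (f : ι → Fin m → ℤ) :
    toReal (∑ i ∈ s, f i) = ∑ i ∈ s, toReal (f i) := by
  ext; simp [toReal]

/-- A lattice point in the real span of some of the `b_i` is moved into their cone by adding
sufficiently many copies of a sum of these vectors. -/
theorem exists_add_mem_cone {T : Set (Fin n)} {z : Fin m → ℤ}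
    (hz : toReal z ∈ Submodule.span ℝ ((fun i => toReal (b i)) '' T)) :
    ∃ (t : Finset (Fin n)) (N : ℤ), ↑t ⊆ T ∧ toReal (z + N • ∑ i ∈ t, b i) ∈ cone b T := by
  obtain ⟨t, ht, c, hc⟩ := Submodule.mem_span_image_iff_exists_fun ℝ |>.1 hz
  refine ⟨t, ⌈∑ i, |c i|⌉, ht, ?_⟩
  rw [toReal_add, toReal_zsmul, toReal_sum, ← hc, Finset.smul_sum, ← Finset.sum_coe_sort t,
    ← Finset.sum_add_distrib]
  refine Submodule.sum_mem _ fun i _ => ?_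
  rw [← add_smul]
  refine PointedCone.smul_mem _ ?_ (toReal_mem_cone (ht i.2))
  have h1 := Int.le_ceil (∑ i, |c i|)
  have h2 := Finset.single_le_sum (f := fun i => |c i|) (fun i _ => abs_nonneg _)
    (Finset.mem_univ i)
  have h3 := neg_abs_le (c i)
  linarith

/-- For a supernormal configuration, a polyhedron `{u | u · b_i ≤ a_i}` all of whose constraints
are attained at lattice points is integral: objectives in the cone of the `b_i` are maximized at
lattice points. -/
theorem Supernormal.exists_lattice_point (hb : Supernormal b) (a : Fin n → ℤ)
    (ha : ∀ i, ∃ z : Fin m → ℤ, (∀ j, z ⬝ᵥ b j ≤ a j) ∧ z ⬝ᵥ b i = a i) {w : Fin m → ℝ}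
    (hw : w ∈ cone b Set.univ) (u : Fin m → ℝ) (hu : ∀ i, u ⬝ᵥ toReal (b i) ≤ a i) :
    ∃ z : Fin m → ℤ, (∀ j, z ⬝ᵥ b j ≤ a j) ∧ u ⬝ᵥ w ≤ toReal z ⬝ᵥ w := by
  obtain ⟨v, hv, huv, hdet⟩ := exists_vertex (fun i => (a i : ℝ)) hw u hu
  let T : Set (Fin n) := {i | v ⬝ᵥ toReal (b i) = a i}
  -- A lattice point `z` attaining `a i` satisfies `z - v ≤ 0` on `T`, hence on its cone, so `a i =
  -- z · b_i ≤ v · b_i`.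
  have hT : ∀ i, toReal (b i) ∈ cone b T → v ⬝ᵥ toReal (b i) = a i := by
    intro i hi
    obtain ⟨z, hz, hzi⟩ := ha i
    have h := dotProduct_nonpos_of_mem_cone (d := toReal z - v) hi fun j hj => by
      have h1 : ((z ⬝ᵥ b j : ℤ) : ℝ) ≤ a j := by exact_mod_cast hz j
      have h2 : v ⬝ᵥ toReal (b j) = a j := hj
      rw [sub_dotProduct, toReal_dotProduct_toReal, h2]
      linarith
    rw [sub_dotProduct, toReal_dotProduct_toReal, hzi] at h
    exact le_antisymm (hv i) (by linarith)
  let M : Submodule ℤ (Fin m → ℤ) :=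
    ((Submodule.span ℝ ((fun i => toReal (b i)) '' T)).restrictScalars ℤ).comap
      (AddMonoidHom.mk' toReal toReal_add).toIntLinearMap
  have hMmem : ∀ z, z ∈ M ↔ toReal z ∈ Submodule.span ℝ ((fun i => toReal (b i)) '' T) :=
    fun z => Iff.rfl
  obtain ⟨z, hz⟩ := exists_integral_form M
    (fun k z hk hz => by
      rw [hMmem, toReal_zsmul] at hz
      exact (hMmem z).2 ((Submodule.smul_mem_iff _ (Int.cast_ne_zero.2 hk)).1 hz)) v
    (fun z hz => by
      obtain ⟨t, N, ht, hcone⟩ := exists_add_mem_cone ((hMmem z).1 hz)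
      have hclosure : ∀ x ∈ AddSubmonoid.closure (b '' {i | toReal (b i) ∈ cone b T}),
          ∃ k : ℤ, v ⬝ᵥ toReal x = k := by
        intro x hx
        induction hx using AddSubmonoid.closure_induction with
        | mem x hx =>
          obtain ⟨i, hi, rfl⟩ := hx
          exact ⟨a i, hT i hi⟩
        | zero => exact ⟨0, by simp [toReal, dotProduct]⟩
        | add x y _ _ hx hy =>
          obtain ⟨k, hk⟩ := hx
          obtain ⟨l, hl⟩ := hy
          exact ⟨k + l, by rw [toReal_add, dotProduct_add, hk, hl]; push_cast; rfl⟩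
      -- Supernormality enters here: the shifted point is an integer combination of vectors `b_i` on
      -- which `v` takes the integral values `a i`.
      obtain ⟨k, hk⟩ := hclosure _ (hb T _ hcone)
      refine ⟨k - N * ∑ i ∈ t, a i, ?_⟩
      have hsum : v ⬝ᵥ toReal (∑ i ∈ t, b i) = ((∑ i ∈ t, a i : ℤ) : ℝ) := by
        rw [toReal_sum, dotProduct_sum]
        push_cast
        exact Finset.sum_congr rfl fun i hi => ht hi
      rw [toReal_add, dotProduct_add, toReal_zsmul, dotProduct_smul, hsum, smul_eq_mul] at hk
      push_cast at hk ⊢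
      linarith)
  have hzb : ∀ j, (toReal z - v) ⬝ᵥ toReal (b j) = 0 := by
    refine hdet _ fun i hi => ?_
    rw [sub_dotProduct, toReal_dotProduct_toReal,
      hz (b i) ((hMmem _).2 (Submodule.subset_span ⟨i, hi, rfl⟩)), sub_self]
  refine ⟨z, fun j => ?_, huv.trans (le_of_eq ?_)⟩
  · have h1 := hzb j
    rw [sub_dotProduct, toReal_dotProduct_toReal] at h1
    have h2 := hv j
    have : ((z ⬝ᵥ b j : ℤ) : ℝ) ≤ a j := by linarith
    exact_mod_cast this
  · have := dotProduct_eq_zero_of_mem_cone hw fun j _ => hzb j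
    rw [sub_dotProduct] at this
    linarith

/-- If `z` maximizes `w` over the lattice points of `{u | u · b_i ≤ a_i}`, then `w` lies in the
cone of those `b_i` that are themselves maximized by `z`. -/
theorem Supernormal.mem_cone_of_isMax (hb : Supernormal b) (a : Fin n → ℤ) {w : Fin m → ℝ}
    (hw : w ∈ cone b Set.univ) {z : Fin m → ℤ} (hz : ∀ j, z ⬝ᵥ b j ≤ a j)
    (hmax : ∀ y : Fin m → ℤ, (∀ j, y ⬝ᵥ b j ≤ a j) → toReal y ⬝ᵥ w ≤ toReal z ⬝ᵥ w) :
    w ∈ cone b {i | ∀ y : Fin m → ℤ, (∀ j, y ⬝ᵥ b j ≤ a j) → y ⬝ᵥ b i ≤ z ⬝ᵥ b i} := by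
  -- Tighten each bound to the maximum of `b_i` over lattice points; it is attained, since the
  -- values are integers bounded by `a i`.
  have hex : ∀ i, ∃ y : Fin m → ℤ, (∀ j, y ⬝ᵥ b j ≤ a j) ∧
      ∀ x : Fin m → ℤ, (∀ j, x ⬝ᵥ b j ≤ a j) → x ⬝ᵥ b i ≤ y ⬝ᵥ b i := by
    intro i
    obtain ⟨k, ⟨y, hy, rfl⟩, hk⟩ := Int.exists_greatest_of_bdd
      (P := fun k => ∃ y : Fin m → ℤ, (∀ j, y ⬝ᵥ b j ≤ a j) ∧ y ⬝ᵥ b i = k)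
      ⟨a i, by rintro _ ⟨y, hy, rfl⟩; exact hy i⟩ ⟨_, z, hz, rfl⟩
    exact ⟨y, hy, fun x hx => hk _ ⟨x, hx, rfl⟩⟩
  choose y hy hymax using hex
  by_contra hnot
  obtain ⟨d, hd, hdw⟩ := exists_dotProduct_pos_of_notMem_cone hnot
  -- `d` is non-positive on the constraints tight at `z`, so a short move along `d` stays in the
  -- tightened polyhedron and increases `w`. Integrality then yields a lattice point better than
  -- `z`.
  have hε : ∃ ε : ℝ, 0 < ε ∧ ∀ i, (toReal z + ε • d) ⬝ᵥ toReal (b i) ≤ ((y i ⬝ᵥ b i : ℤ) : ℝ) := by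
    have h0 : ∀ i, ∀ᶠ ε : ℝ in nhdsWithin 0 (Set.Ioi 0),
        (toReal z + ε • d) ⬝ᵥ toReal (b i) ≤ ((y i ⬝ᵥ b i : ℤ) : ℝ) := by
      intro i
      simp only [add_dotProduct, smul_dotProduct, smul_eq_mul, toReal_dotProduct_toReal]
      rcases (hymax i z hz).eq_or_lt with h | h
      · filter_upwards [self_mem_nhdsWithin] with ε hε
        have := hd i fun x hx => (hymax i x hx).trans h.ge
        rw [h]
        have := mul_nonpos_of_nonneg_of_nonpos (le_of_lt hε) this
        linarith
      · have hc : Filter.Tendsto (fun ε : ℝ => ((z ⬝ᵥ b i : ℤ) : ℝ) + ε * (d ⬝ᵥ toReal (b i)))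
            (nhdsWithin 0 (Set.Ioi 0)) (nhds ((z ⬝ᵥ b i : ℤ) : ℝ)) := by
          have : Continuous fun ε : ℝ => ((z ⬝ᵥ b i : ℤ) : ℝ) + ε * (d ⬝ᵥ toReal (b i)) := by
            fun_prop
          simpa using (this.tendsto 0).mono_left nhdsWithin_le_nhds
        exact (hc.eventually_lt_const (Int.cast_lt.2 h)).mono fun _ h => h.le
    obtain ⟨ε, h1, h2⟩ := ((Filter.eventually_all.2 h0).and self_mem_nhdsWithin).exists
    exact ⟨ε, h2, h1⟩
  obtain ⟨ε, hε0, hε⟩ := hε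
  obtain ⟨x, hx, hxw⟩ := hb.exists_lattice_point (fun i => y i ⬝ᵥ b i)
    (fun i => ⟨y i, fun j => hymax j _ (hy i), rfl⟩) hw _ hε
  have h1 := hmax x fun j => (hx j).trans (hy j j)
  rw [add_dotProduct, smul_dotProduct, smul_eq_mul] at hxw
  have := mul_pos hε0 hdw
  linarith

/-- Points in the same cell of the chamber complex have the same maximizers over the lattice points
of `{u | u · b_i ≤ a_i}`. -/
theorem Supernormal.isMax_of_cone_iff (hb : Supernormal b) (a : Fin n → ℤ) {w w' : Fin m → ℝ}
    (hw' : w' ∈ cone b Set.univ) (hcell : ∀ S : Set (Fin n), w' ∈ cone b S ↔ w ∈ cone b S)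
    {z y : Fin m → ℤ} (hz : ∀ j, z ⬝ᵥ b j ≤ a j)
    (hmax : ∀ y : Fin m → ℤ, (∀ j, y ⬝ᵥ b j ≤ a j) → toReal y ⬝ᵥ w' ≤ toReal z ⬝ᵥ w')
    (hy : ∀ j, y ⬝ᵥ b j ≤ a j) :
    toReal y ⬝ᵥ w ≤ toReal z ⬝ᵥ w ∧
      (toReal y ⬝ᵥ w = toReal z ⬝ᵥ w → toReal y ⬝ᵥ w' = toReal z ⬝ᵥ w') := by
  obtain ⟨c, hc, hcS, hsum⟩ := mem_cone_iff.1 ((hcell _).1 (hb.mem_cone_of_isMax a hw' hz hmax))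
  have hle : ∀ i, c i * ((toReal y - toReal z) ⬝ᵥ toReal (b i)) ≤ 0 := by
    intro i
    by_cases hi : ∀ y : Fin m → ℤ, (∀ j, y ⬝ᵥ b j ≤ a j) → y ⬝ᵥ b i ≤ z ⬝ᵥ b i
    · refine mul_nonpos_of_nonneg_of_nonpos (hc i) ?_
      rw [sub_dotProduct, toReal_dotProduct_toReal, toReal_dotProduct_toReal, sub_nonpos]
      exact_mod_cast hi y hy
    · simp [hcS i hi]
  have hw : (toReal y - toReal z) ⬝ᵥ w
      = ∑ i, c i * ((toReal y - toReal z) ⬝ᵥ toReal (b i)) := by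
    rw [hsum, dotProduct_sum]
    simp only [dotProduct_smul, smul_eq_mul]
  refine ⟨?_, fun heq => ?_⟩
  · rw [← sub_nonpos, ← sub_dotProduct, hw]
    exact Finset.sum_nonpos fun i _ => hle i
  · rw [← sub_eq_zero, ← sub_dotProduct] at heq ⊢
    rw [hw, Finset.sum_eq_zero_iff_of_nonpos fun i _ => hle i] at heq
    -- Complementary slackness: `y - z` vanishes on the support of `c`, whose cone contains `w`,
    -- hence also `w'`.
    refine dotProduct_eq_zero_of_mem_cone (S := {i | c i ≠ 0}) ((hcell _).2 ?_) fun i hi =>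
      (mul_eq_zero.1 (heq i (Finset.mem_univ i))).resolve_left hi
    exact mem_cone_iff.2 ⟨c, hc, fun i hi => not_not.1 hi, hsum⟩

/-! ### Chambers determine initial ideals -/

variable (k : Type*) [Field k]

theorem posMonomial_dvd {u v : Fin m → ℤ} (h : ∀ i, v ⬝ᵥ b i ≤ max (u ⬝ᵥ b i) 0) :
    posMonomial k b v ∣ posMonomial k b u :=
  Finset.prod_dvd_prod_of_dvd _ _ fun i _ => pow_dvd_pow _ (by have := h i; omega)

theorem binomial_neg (u : Fin m → ℤ) : binomial k b (-u) = -binomial k b u := by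
  simp [binomial]

theorem posMonomial_mem_initialIdeal {u v : Fin m → ℤ} {w : Fin m → ℝ} (hv : 0 < toReal v ⬝ᵥ w)
    (h : ∀ i, v ⬝ᵥ b i ≤ max (u ⬝ᵥ b i) 0) : posMonomial k b u ∈ initialIdeal k b w :=
  Ideal.mem_of_dvd _ (posMonomial_dvd k h) (Ideal.subset_span (Or.inl ⟨v, hv, rfl⟩))

/-- A generator missing from `in_{w'}` would make `0` or `u` optimal for `w'`. Optimality passes to
`w`, and ties for `w` are ties for `w'`; either way the sign of `u · w` or `u · w'` is contradicted.
-/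
theorem Supernormal.initialIdeal_le (hb : Supernormal b) {w w' : Fin m → ℝ}
    (hw' : w' ∈ cone b Set.univ) (hcell : ∀ S : Set (Fin n), w' ∈ cone b S ↔ w ∈ cone b S) :
    initialIdeal k b w ≤ initialIdeal k b w' := by
  have hpos : ∀ u : Fin m → ℤ, toReal u ⬝ᵥ w = 0 → 0 < toReal u ⬝ᵥ w' →
      binomial k b u ∈ initialIdeal k b w' := by
    intro u hu hu'
    -- Both terms of the binomial lie in `in_{w'}`: if the second did not, `u` would be optimal for
    -- `w'`, yet `0` ties with it for `w`.
    refine Ideal.sub_mem _ (posMonomial_mem_initialIdeal k hu' fun i => le_max_left _ _) ?_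
    by_contra hnot
    have hmax : ∀ y : Fin m → ℤ, (∀ j, y ⬝ᵥ b j ≤ max (u ⬝ᵥ b j) 0) →
        toReal y ⬝ᵥ w' ≤ toReal u ⬝ᵥ w' := by
      intro y hy
      by_contra! hlt
      refine hnot (posMonomial_mem_initialIdeal k (v := y - u) ?_ fun i => ?_)
      · rw [toReal_sub, sub_dotProduct]
        linarith
      · have := hy i
        rw [sub_dotProduct, neg_dotProduct]
        omega
    have h := (hb.isMax_of_cone_iff _ hw' hcell (y := 0) (fun j => le_max_left _ _) hmax
      (fun j => by simp)).2
    have h0 : toReal (0 : Fin m → ℤ) = 0 := by ext; simp [toReal]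
    simp only [h0, zero_dotProduct] at h
    exact hu'.ne (h hu.symm)
  refine Ideal.span_le.2 ?_
  rintro p (⟨u, hu, rfl⟩ | ⟨u, hu, rfl⟩)
  · by_contra hnot
    have hmax : ∀ y : Fin m → ℤ, (∀ j, y ⬝ᵥ b j ≤ max (u ⬝ᵥ b j) 0) →
        toReal y ⬝ᵥ w' ≤ toReal (0 : Fin m → ℤ) ⬝ᵥ w' := by
      intro y hy
      by_contra! hlt
      refine hnot (posMonomial_mem_initialIdeal k ?_ hy)
      simpa [toReal, dotProduct] using hlt
    have h := (hb.isMax_of_cone_iff _ hw' hcell (y := u) (fun j => by simp) hmax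
      (fun j => le_max_left _ _)).1
    have h0 : toReal (0 : Fin m → ℤ) = 0 := by ext; simp [toReal]
    rw [h0, zero_dotProduct] at h
    exact absurd hu (not_lt.2 h)
  · rcases lt_trichotomy 0 (toReal u ⬝ᵥ w') with h | h | h
    · exact hpos u hu h
    · exact Ideal.subset_span (Or.inr ⟨u, h.symm, rfl⟩)
    · have := hpos (-u) (by rw [toReal_neg, neg_dotProduct, hu, neg_zero])
        (by rw [toReal_neg, neg_dotProduct]; linarith)
      rw [binomial_neg] at this
      exact neg_mem_iff.1 this

/-! ### Initial ideals determine chambers -/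

/-- A point outside `cone b S` is separated from it by an integral linear functional. -/
theorem exists_int_dotProduct_pos_of_notMem_cone {S : Set (Fin n)} {w : Fin m → ℝ}
    (hw : w ∈ cone b Set.univ) (hS : w ∉ cone b S) :
    ∃ z : Fin m → ℤ, (∀ i ∈ S, z ⬝ᵥ b i ≤ 0) ∧ 0 < toReal z ⬝ᵥ w := by
  classical
  obtain ⟨d, hd, hdw⟩ := exists_dotProduct_pos_of_notMem_cone hS
  let K : ℝ := 1 + ∑ i, |d ⬝ᵥ toReal (b i)|
  have hK : 0 < K := by positivity
  -- Scaling by `K⁻¹` makes `d` feasible for the bounds 0 on `S` and 1 elsewhere; integral bounds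
  -- are what allows a rational replacement of the vertex.
  obtain ⟨v, hv, hdv, hdet⟩ := exists_vertex (b := b) (fun i => if i ∈ S then (0 : ℝ) else 1) hw
    (K⁻¹ • d) (fun i => by
      rw [smul_dotProduct, smul_eq_mul]
      split_ifs with hi
      · exact mul_nonpos_of_nonneg_of_nonpos (by positivity) (hd i hi)
      · rw [inv_mul_le_iff₀ hK, mul_one]
        have h1 := Finset.single_le_sum (f := fun i => |d ⬝ᵥ toReal (b i)|)
          (fun i _ => abs_nonneg _) (Finset.mem_univ i)
        have h2 := le_abs_self (d ⬝ᵥ toReal (b i))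
        simp only [K]
        linarith)
  have hvw : 0 < v ⬝ᵥ w := by
    refine lt_of_lt_of_le ?_ hdv
    rw [smul_dotProduct, smul_eq_mul]
    positivity
  -- A `ℚ`-linear retraction `ℝ → ℚ`, applied to the coordinates of `v`, preserves the rational
  -- values on tight constraints; the vertex property then gives agreement on every `b_j`.
  obtain ⟨f, hf⟩ := (Algebra.linearMap ℚ ℝ).exists_leftInverse_of_injective
    (LinearMap.ker_eq_bot.2 (algebraMap ℚ ℝ).injective)
  have hfq : ∀ q : ℚ, f (q : ℝ) = q := fun q => LinearMap.congr_fun hf q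
  let q : Fin m → ℚ := fun i => f (v i)
  have hq : ∀ z : Fin m → ℤ, ((q ⬝ᵥ fun i => (z i : ℚ)) : ℚ) = f (v ⬝ᵥ toReal z) := by
    intro z
    simp only [dotProduct, map_sum, q, toReal]
    refine Finset.sum_congr rfl fun i _ => ?_
    have : v i * (z i : ℝ) = (z i : ℚ) • v i := by
      rw [Rat.smul_def, mul_comm]; simp
    rw [this, map_smul, smul_eq_mul, mul_comm]
  have hqr : ∀ z : Fin m → ℤ, (fun i => (q i : ℝ)) ⬝ᵥ toReal z = (f (v ⬝ᵥ toReal z) : ℝ) := by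
    intro z
    rw [← hq]
    simp [dotProduct, toReal]
  have hqv : ∀ j, ((fun i => (q i : ℝ)) - v) ⬝ᵥ toReal (b j) = 0 := by
    refine hdet _ fun i hi => ?_
    rw [sub_dotProduct, hqr, hi]
    split_ifs
    · simp
    · have := hfq 1
      simp only [Rat.cast_one] at this
      simp [this]
  obtain ⟨N, hN, z, hz⟩ : ∃ N : ℕ, 0 < N ∧ ∃ z : Fin m → ℤ, ∀ i, (z i : ℝ) = N * (q i : ℝ) := by
    refine ⟨∏ i, (q i).den, Finset.prod_pos fun i _ => (q i).den_pos, ?_⟩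
    choose c hc using fun i => Finset.dvd_prod_of_mem (fun i => (q i).den) (Finset.mem_univ i)
    refine ⟨fun i => c i * (q i).num, fun i => ?_⟩
    have h : (q i : ℝ) * (q i).den = (q i).num := by exact_mod_cast Rat.mul_den_eq_num (q i)
    rw [hc i]
    push_cast
    rw [← h]
    ring
  have hzq : toReal z = (N : ℝ) • fun i => (q i : ℝ) := by
    ext i
    simp [toReal, hz]
  have hN' : (0 : ℝ) < N := by exact_mod_cast hN
  refine ⟨z, fun i hi => ?_, ?_⟩
  · have h1 := hqv i
    have h2 := hv i
    rw [if_pos hi] at h2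
    rw [sub_dotProduct] at h1
    have : ((z ⬝ᵥ b i : ℤ) : ℝ) ≤ 0 := by
      rw [← toReal_dotProduct_toReal, hzq, smul_dotProduct, smul_eq_mul]
      exact mul_nonpos_of_nonneg_of_nonpos hN'.le (by linarith)
    exact_mod_cast this
  · have h1 := dotProduct_eq_zero_of_mem_cone hw fun j _ => hqv j
    rw [sub_dotProduct] at h1
    rw [hzq, smul_dotProduct, smul_eq_mul]
    exact mul_pos hN' (by linarith)

/-- The initial ideal at a point of `cone b S` contains no monomial in the variables outside
`S`. -/
theorem posMonomial_notMem_initialIdeal {S : Set (Fin n)} {w : Fin m → ℝ} (hw : w ∈ cone b S)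
    {u : Fin m → ℤ} (hu : ∀ i ∈ S, u ⬝ᵥ b i ≤ 0) : posMonomial k b u ∉ initialIdeal k b w := by
  classical
  obtain ⟨c, hc, hcS, hsum⟩ := mem_cone_iff.1 hw
  -- The point is 0 on the support of `c` and 1 elsewhere; a positive monomial is 1 at it or
  -- vanishes, according to the signs on that support.
  let p : Fin n → k := fun i => if c i = 0 then 1 else 0
  have hone : ∀ v : Fin m → ℤ, (∀ i, c i ≠ 0 → v ⬝ᵥ b i ≤ 0) →
      MvPolynomial.eval p (posMonomial k b v) = 1 := by
    intro v hv
    simp only [posMonomial, map_prod, map_pow, MvPolynomial.eval_X, p]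
    refine Finset.prod_eq_one fun i _ => ?_
    split_ifs with h
    · exact one_pow _
    · rw [Int.toNat_eq_zero.2 (hv i h), pow_zero]
  have hzero : ∀ v : Fin m → ℤ, (∃ i, c i ≠ 0 ∧ 0 < v ⬝ᵥ b i) →
      MvPolynomial.eval p (posMonomial k b v) = 0 := by
    rintro v ⟨i, hi, hv⟩
    simp only [posMonomial, map_prod, map_pow, MvPolynomial.eval_X, p]
    refine Finset.prod_eq_zero (Finset.mem_univ i) ?_
    rw [if_neg hi, zero_pow]
    omega
  have hcone : w ∈ cone b {i | c i ≠ 0} := mem_cone_iff.2 ⟨c, hc, fun i hi => not_not.1 hi, hsum⟩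
  have hpos : ∀ v : Fin m → ℤ, 0 < toReal v ⬝ᵥ w → ∃ i, c i ≠ 0 ∧ 0 < v ⬝ᵥ b i := by
    intro v hv
    by_contra! H
    refine absurd (dotProduct_nonpos_of_mem_cone hcone fun i hi => ?_) (not_le.2 hv)
    rw [toReal_dotProduct_toReal]
    exact_mod_cast H i hi
  have hle : initialIdeal k b w ≤ RingHom.ker (MvPolynomial.eval p) := by
    refine Ideal.span_le.2 ?_
    rintro f (⟨v, hv, rfl⟩ | ⟨v, hv, rfl⟩)
    · exact hzero v (hpos v hv)
    · have hiff : ∀ v : Fin m → ℤ, toReal v ⬝ᵥ w = 0 → (∃ i, c i ≠ 0 ∧ 0 < v ⬝ᵥ b i) →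
          ∃ i, c i ≠ 0 ∧ 0 < (-v) ⬝ᵥ b i := by
        rintro v hv ⟨i, hi, hvi⟩
        by_contra! H
        have hterm : ∀ j, 0 ≤ c j * (toReal v ⬝ᵥ toReal (b j)) := by
          intro j
          by_cases hj : c j = 0
          · simp [hj]
          · refine mul_nonneg (hc j) ?_
            have := H j hj
            rw [neg_dotProduct] at this
            rw [toReal_dotProduct_toReal]
            exact_mod_cast (by omega : 0 ≤ v ⬝ᵥ b j)
        rw [hsum, dotProduct_sum] at hv
        simp only [dotProduct_smul, smul_eq_mul] at hv
        have h := (Finset.sum_eq_zero_iff_of_nonneg fun j _ => hterm j).1 hv i (Finset.mem_univ i)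
        rw [toReal_dotProduct_toReal] at h
        rcases mul_eq_zero.1 h with h | h
        · exact hi h
        · exact hvi.ne' (by exact_mod_cast h)
      change MvPolynomial.eval p (binomial k b v) = 0
      rw [binomial, map_sub]
      by_cases h : ∃ i, c i ≠ 0 ∧ 0 < v ⬝ᵥ b i
      · rw [hzero v h, hzero _ (hiff v hv h), sub_zero]
      · have h' : ¬∃ i, c i ≠ 0 ∧ 0 < (-v) ⬝ᵥ b i := fun h' => h (by
          simpa using hiff (-v) (by rw [toReal_neg, neg_dotProduct, hv, neg_zero]) h')
        push Not at h h'
        rw [hone v h, hone _ h', sub_self]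
  intro hmem
  have h0 := hle hmem
  rw [RingHom.mem_ker, hone u fun i hi => hu i (not_not.1 fun h => hi (hcS i h))] at h0
  exact one_ne_zero h0

theorem mem_cone_of_initialIdeal_le {S : Set (Fin n)} {w w' : Fin m → ℝ}
    (hw' : w' ∈ cone b Set.univ) (h : initialIdeal k b w' ≤ initialIdeal k b w)
    (hw : w ∈ cone b S) : w' ∈ cone b S := by
  by_contra hnot
  obtain ⟨u, hu, huw⟩ := exists_int_dotProduct_pos_of_notMem_cone hw' hnot
  exact posMonomial_notMem_initialIdeal k hw hu
    (h (posMonomial_mem_initialIdeal k huw fun i => le_max_left _ _))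

theorem Supernormal.chamberCell_eq_groebnerCell (hb : Supernormal b) {w : Fin m → ℝ}
    (hw : w ∈ cone b Set.univ) : chamberCell b w = groebnerCell k b w := by
  ext w'
  refine and_congr_right fun hw' => ⟨fun h => ?_, fun h S => ?_⟩
  · exact le_antisymm (hb.initialIdeal_le k hw fun S => (h S).symm) (hb.initialIdeal_le k hw' h)
  · exact ⟨mem_cone_of_initialIdeal_le k hw h.ge, mem_cone_of_initialIdeal_le k hw' h.le⟩

end VectorConfig

theorem theorem1p1 (k : Type*) [Field k] (m n : ℕ) (b : Fin n → Fin m → ℤ)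
    (hb : VectorConfig.Supernormal b) :
    VectorConfig.chamberComplex b = VectorConfig.groebnerFan k b := by
  ext C
  exact exists_congr fun w => and_congr_right fun hw => by
    rw [hb.chamberCell_eq_groebnerCell k hw]
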